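/- Let $\Gamma$ be a bipartite distance-regular graph with vertex set $X$, path-length distance $\partial$, diameter $D\ge 4$, valency $k\ge 3$, and intersection numbers $b_i=|\{z\in X:\partial(x,z)=1,\ \partial(z,y)=i+1\}|$ (for any $x,y\in X$ with $\partial(x,y)=i$). Let $A$ be the adjacency matrix and $A_2$ the distance-2 matrix of $\Gamma$. Let $\theta_0>\theta_1>\cdots>\theta_D$ be the distinct eigenvalues of $A$, let $E_i$ be the primitive idempotent of $A$ associated with $\theta_i$ (the matrix of the orthogonal projection of $V=\mathbb C^X$, with its Hermitian inner product, onto the $\theta_i$-eigenspace of $A$), and let $m_i=\operatorname{rank}E_i$. Fix $x\in X$; for $0\le i\le D$ let $E_i^*$ be the diagonal matrix whose $(y,y)$-entry is $1$ if $\partial(x,y)=i$ and $0$ otherwise, and let $T$ be the subalgebra of $\mathrm{Mat}_X(\mathbb C)$ generated by $A,E_0^*,\dots,E_D^*$. A $T$-module is a $T$-invariant subspace $W\subseteq V$; it is irreducible if $W\ne 0$ and its only $T$-submodules are $0$ and $W$; an irreducible $W$ is thin if $\dim E_i^*W\le 1$ for $0\le i\le D$; its endpoint is $\min\{i: E_i^*W\neq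 0\}$. If $W$ is thin irreducible with endpoint $2$, then its local eigenvalue is the eigenvalue of $E_2^*A_2E_2^*$ on the one-dimensional space $E_2^*W$. Let $n\in\{1,\lfloor D/2\rfloor\}$ if $D$ is odd, and $n=1$ if $D$ is even. Let $W$ be a thin irreducible $T$-module with endpoint $2$ and local eigenvalue $$\tilde\theta_n=-1-\frac{b_2b_3}{\theta_n^2-b_2},$$ and let $v$ be a nonzero vector in $E_2^*W$. Then the vectors $E_iv$ $(1\le i\le D-1,\ i\ne n,\ i\ne D-n)$ are mutually orthogonal, and for each such $i$ $$\|E_iv\|^2=\frac{m_i(\theta_i^2-k^2)(\theta_i^2-\theta_n^2)}{|X|\,k\,b_1(\theta_n^2-b_2)}\,\|v\|^2,$$ where the denominator $|X|\,k\,b_1(\theta_n^2-b_2)$ is nonzero. -/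

import Mathlib

namespace DRG

/-- A finite graph is distance-regular if it is connected and, for all `h i j`, the number of
vertices `z` with `∂(x,z) = i` and `∂(z,y) = j` is the same for all vertices `x y` with
`∂(x,y) = h`. -/
structure IsDistanceRegular {X : Type*} [Fintype X] (G : SimpleGraph X) : Prop where
  connected : G.Connected
  card_eq : ∀ (h i j : ℕ) (x y x' y' : X), G.dist x y = h → G.dist x' y' = h →
    (Finset.univ.filter fun z : X => G.dist x z = i ∧ G.dist z y = j).card =
      (Finset.univ.filter fun z : X => G.dist x' z = i ∧ G.dist z y' = j).card

open Classical in
/-- The intersection number `p^h_{ij}` of a distance-regular graph: the number of `z` with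
`∂(x,z) = i` and `∂(z,y) = j`, where `x y` is any pair of vertices at distance `h`
(and `0` if there is no such pair, i.e. if `h` exceeds the diameter). -/
noncomputable def intersectionNumber {X : Type*} [Fintype X] (G : SimpleGraph X)
    (h i j : ℕ) : ℕ :=
  if H : ∃ q : X × X, G.dist q.1 q.2 = h then
    (Finset.univ.filter fun z : X => G.dist H.choose.1 z = i ∧ G.dist z H.choose.2 = j).card
  else 0

theorem IsDistanceRegular.card_eq_intersectionNumber {X : Type*} [Fintype X]
    {G : SimpleGraph X} (hG : IsDistanceRegular G) (i j : ℕ) (x y : X) :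
    (Finset.univ.filter fun z : X => G.dist x z = i ∧ G.dist z y = j).card =
      intersectionNumber G (G.dist x y) i j := by
  have H : ∃ q : X × X, G.dist q.1 q.2 = G.dist x y := ⟨(x, y), rfl⟩
  unfold intersectionNumber
  rw [dif_pos H]
  exact hG.card_eq (G.dist x y) i j x y _ _ rfl H.choose_spec

/-- The intersection number `b_i = p^i_{1,i+1}`. -/
noncomputable def b {X : Type*} [Fintype X] (G : SimpleGraph X) (i : ℕ) : ℕ :=
  intersectionNumber G i 1 (i + 1)

/-- The valency `k = b_0` of a distance-regular graph. -/
noncomputable def valency {X : Type*} [Fintype X] (G : SimpleGraph X) : ℕ := b G 0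

/-- The `i`-th distance matrix `A_i`. -/
noncomputable def distanceMatrix {X : Type*} (G : SimpleGraph X) (i : ℕ) : Matrix X X ℂ :=
  Matrix.of fun x y => if G.dist x y = i then 1 else 0

/-- The adjacency matrix `A = A_1`. -/
noncomputable def adjacencyMatrix {X : Type*} (G : SimpleGraph X) : Matrix X X ℂ :=
  distanceMatrix G 1

theorem adjacencyMatrix_eq_adjMatrix {X : Type*} (G : SimpleGraph X) [DecidableRel G.Adj] :
    adjacencyMatrix G = G.adjMatrix ℂ := by
  ext x y
  simp [adjacencyMatrix, distanceMatrix, SimpleGraph.adjMatrix_apply,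
    SimpleGraph.dist_eq_one_iff_adj]

/-- The action of a matrix on the standard module `V = ℂ^X`, which carries the Hermitian
inner product. -/
noncomputable def act {X : Type*} [Fintype X] [DecidableEq X] (B : Matrix X X ℂ) :
    EuclideanSpace ℂ X →ₗ[ℂ] EuclideanSpace ℂ X :=
  Matrix.toEuclideanLin B

/-- The eigenvalue `θ_i`: the `i`-th entry (counted from `0`) of the list of distinct
eigenvalues of the adjacency matrix in decreasing order. A distance-regular graph of
diameter `D` has exactly `D + 1` distinct eigenvalues, all real, so the default value is never
reached for `i ≤ D`. -/
noncomputable def eigenvalue {X : Type*} [Fintype X] [DecidableEq X] (G : SimpleGraph X)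
    (i : ℕ) : ℝ :=
  ((Matrix.finite_real_spectrum (A := adjacencyMatrix G)).toFinset.sort (· ≥ ·)).getD i 0

/-- The primitive idempotent `E_i` associated with `θ_i`: the matrix of the orthogonal
projection of `V` onto the eigenspace of the adjacency matrix for `θ_i`. -/
noncomputable def primitiveIdempotent {X : Type*} [Fintype X] [DecidableEq X]
    (G : SimpleGraph X) (i : ℕ) : Matrix X X ℂ :=
  Matrix.toEuclideanLin.symm
    (Module.End.eigenspace (act (adjacencyMatrix G)) (eigenvalue G i : ℂ)).starProjection

/-- The multiplicity `m_i`, the rank of `E_i`. -/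
noncomputable def multiplicity {X : Type*} [Fintype X] [DecidableEq X] (G : SimpleGraph X)
    (i : ℕ) : ℕ :=
  (primitiveIdempotent G i).rank

/-- The `i`-th dual idempotent `E*_i` with respect to the base vertex `x`. -/
noncomputable def dualIdempotent {X : Type*} [DecidableEq X] (G : SimpleGraph X) (x : X)
    (i : ℕ) : Matrix X X ℂ :=
  Matrix.diagonal fun y => if G.dist x y = i then 1 else 0

/-- The Bose-Mesner algebra `M`, generated by the adjacency matrix. -/
noncomputable def boseMesnerAlgebra {X : Type*} [Fintype X] [DecidableEq X]
    (G : SimpleGraph X) : Subalgebra ℂ (Matrix X X ℂ) :=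
  Algebra.adjoin ℂ {adjacencyMatrix G}

/-- The dual Bose-Mesner algebra `M*` with respect to `x`, generated by the `E*_i`. -/
noncomputable def dualBoseMesnerAlgebra {X : Type*} [Fintype X] [DecidableEq X]
    (G : SimpleGraph X) (x : X) : Subalgebra ℂ (Matrix X X ℂ) :=
  Algebra.adjoin ℂ (Set.range (dualIdempotent G x))

/-- The subconstituent (Terwilliger) algebra `T = T(x)`, generated by `M` and `M*`. -/
noncomputable def subconstituentAlgebra {X : Type*} [Fintype X] [DecidableEq X]
    (G : SimpleGraph X) (x : X) : Subalgebra ℂ (Matrix X X ℂ) :=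
  boseMesnerAlgebra G ⊔ dualBoseMesnerAlgebra G x

/-- A `T`-module: a subspace of `V` invariant under `T`. -/
def IsTModule {X : Type*} [Fintype X] [DecidableEq X] (G : SimpleGraph X) (x : X)
    (W : Submodule ℂ (EuclideanSpace ℂ X)) : Prop :=
  ∀ B ∈ subconstituentAlgebra G x, ∀ w ∈ W, act B w ∈ W

/-- An irreducible `T`-module: nonzero, with no `T`-modules inside other than `0` and itself. -/
structure IsIrreducibleTModule {X : Type*} [Fintype X] [DecidableEq X] (G : SimpleGraph X)
    (x : X) (W : Submodule ℂ (EuclideanSpace ℂ X)) : Prop where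
  isTModule : IsTModule G x W
  ne_bot : W ≠ ⊥
  eq_bot_or_eq : ∀ W' : Submodule ℂ (EuclideanSpace ℂ X), IsTModule G x W' → W' ≤ W →
    W' = ⊥ ∨ W' = W

/-- The subspace `E*_i W`. -/
noncomputable def dualComponent {X : Type*} [Fintype X] [DecidableEq X] (G : SimpleGraph X)
    (x : X) (i : ℕ) (W : Submodule ℂ (EuclideanSpace ℂ X)) :
    Submodule ℂ (EuclideanSpace ℂ X) :=
  W.map (act (dualIdempotent G x i))

/-- `W` is thin: `dim E*_i W ≤ 1` for `0 ≤ i ≤ D`. -/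
def IsThin {X : Type*} [Fintype X] [DecidableEq X] (G : SimpleGraph X) (x : X)
    (W : Submodule ℂ (EuclideanSpace ℂ X)) : Prop :=
  ∀ i ≤ G.diam, Module.finrank ℂ (dualComponent G x i W) ≤ 1

/-- The endpoint of `W`: the least `i` with `0 ≤ i ≤ D` and `E*_i W ≠ 0`. -/
noncomputable def endpoint {X : Type*} [Fintype X] [DecidableEq X] (G : SimpleGraph X)
    (x : X) (W : Submodule ℂ (EuclideanSpace ℂ X)) : ℕ :=
  sInf {i : ℕ | i ≤ G.diam ∧ dualComponent G x i W ≠ ⊥}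

/-- `η` is the local eigenvalue of `W`, a thin irreducible `T`-module with endpoint 2:
`E*_2 A_2 E*_2` acts on the one-dimensional space `E*_2 W` as `η`. -/
def HasLocalEigenvalue {X : Type*} [Fintype X] [DecidableEq X] (G : SimpleGraph X) (x : X)
    (W : Submodule ℂ (EuclideanSpace ℂ X)) (η : ℝ) : Prop :=
  ∀ w ∈ dualComponent G x 2 W,
    act (dualIdempotent G x 2 * distanceMatrix G 2 * dualIdempotent G x 2) w = (η : ℂ) • w

/-- `z̃ = -1 - b_2 b_3 / (z² - b_2)`, for real `z` with `z² ≠ b_2`. -/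
noncomputable def tilde {X : Type*} [Fintype X] (G : SimpleGraph X) (z : ℝ) : ℝ :=
  -1 - (b G 2 : ℝ) * b G 3 / (z ^ 2 - b G 2)

end DRG

/-! Orthogonality is immediate: the vectors lie in eigenspaces of the Hermitian matrix `A` for
different eigenvalues. For the norm, let `E` be the projection onto the `θ`-eigenspace. It is a
polynomial in `A`, so its entries are `q (∂(y,z))` for one sequence `q` (`exists_cosine`). Vertices
at distance 2 from `x` are at mutual distance 0, 2 or 4, and `v` sums to zero because the endpoint
is not 0. Hence `‖Ev‖² = ⟨v, Ev⟩ = (q 0 + η q 2 - (1 + η) q 4) ‖v‖²` with `η` the local eigenvalue.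

The three-term recurrence makes this `q 0` times a quadratic in `θ²`. One root is `k²`, and `η =
tilde G τ` puts the other at `τ²`; finally `|X| q 0 = rank E`. Both roots make `Ev` vanish, which
accounts for the omitted indices.

The denominator requires `θ_n² ≠ b_2`. Test vectors supported on a geodesic show that `θ_1² > b_2`
and, for odd `D`, that the smallest positive eigenvalue has square below `b_2`
(`eigenvalue_sq_ne_b`). -/

namespace DRG

/-! ### Distances and intersection numbers in the bipartite case. -/

section Combinatorics

variable {X : Type*} {G : SimpleGraph X}

/-- Realizes every distance up to the diameter, so that each intersection number used later counts
an actual configuration instead of taking the default 0. -/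
theorem exists_geodesic [Nonempty X] (hG : G.Connected) :
    ∃ γ : ℕ → X, ∀ i j, i ≤ j → j ≤ G.diam → G.dist (γ i) (γ j) = j - i := by
  obtain ⟨u, v, huv⟩ := G.exists_dist_eq_diam
  obtain ⟨p, hp⟩ := hG.exists_walk_length_eq_dist u v
  have hle : ∀ i j, i ≤ j → j ≤ G.diam → G.dist (p.getVert i) (p.getVert j) ≤ j - i := by
    intro i j hij
    induction j, hij using Nat.le_induction with
    | base => simp
    | succ j hij ih =>
      intro hj
      have h1 := ih (by omega)
      have h2 : G.dist (p.getVert j) (p.getVert (j + 1)) = 1 :=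
        SimpleGraph.dist_eq_one_iff_adj.mpr (p.adj_getVert_succ (by omega))
      have h3 := hG.dist_triangle (u := p.getVert i) (v := p.getVert j) (w := p.getVert (j + 1))
      omega
  refine ⟨p.getVert, fun i j hij hj => le_antisymm (hle i j hij hj) ?_⟩
  have h1 := hle 0 i (by omega) (by omega)
  have h2 := hle j G.diam hj le_rfl
  have h3 := hG.dist_triangle (u := u) (v := p.getVert i) (w := v)
  have h4 := hG.dist_triangle (u := p.getVert i) (v := p.getVert j) (w := v)
  have h5 : p.getVert G.diam = v := by rw [← huv, ← hp, p.getVert_length]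
  rw [p.getVert_zero] at h1
  rw [h5] at h2
  omega

theorem even_dist_iff (hG : G.Connected) (c : G.Coloring Bool) (u v : X) :
    Even (G.dist u v) ↔ (c u ↔ c v) := by
  obtain ⟨p, hp⟩ := hG.exists_walk_length_eq_dist u v
  rw [← hp, c.even_length_iff_congr]

theorem exists_coloring_bool (hbip : G.IsBipartite) : Nonempty (G.Coloring Bool) :=
  Nonempty.map (SimpleGraph.recolorOfEquiv G finTwoEquiv) hbip

/-- In a connected bipartite graph, moving to a neighbour changes the distance to a fixed vertex by
exactly one. -/
theorem dist_of_adj (hG : G.Connected) (hbip : G.IsBipartite) {y w : X} (z : X)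
    (h : G.dist y w = 1) :
    G.dist w z + 1 = G.dist y z ∨ G.dist w z = G.dist y z + 1 := by
  obtain ⟨c⟩ := exists_coloring_bool hbip
  have h1 := hG.dist_triangle (u := y) (v := w) (w := z)
  have h2 := hG.dist_triangle (u := w) (v := y) (w := z)
  rw [G.dist_comm (u := w) (v := y), h] at h2
  rw [h] at h1
  have hc := c.valid (SimpleGraph.dist_eq_one_iff_adj.mp h)
  have hw := even_dist_iff hG c w z
  have hy := even_dist_iff hG c y z
  have : G.dist w z ≠ G.dist y z := by
    intro he
    rw [he, hy] at hw
    cases h1 : c y <;> cases h2 : c w <;> cases h3 : c z <;> simp_all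
  omega

/-- The intersection number `c_i = p^i_{1,i-1}`. -/
noncomputable def c [Fintype X] (G : SimpleGraph X) (i : ℕ) : ℕ :=
  intersectionNumber G i 1 (i - 1)

variable [Fintype X]

/-- Bipartiteness leaves only neighbours of `y` one step closer to `z` or one step farther, so there
is no `a_i` term. Constant `f` gives row sums of `A`; the indicator of 1 gives entries of `A²`. -/
theorem sum_adjacencyMatrix_mul (hG : IsDistanceRegular G) (hbip : G.IsBipartite) (f : ℕ → ℂ)
    (y z : X) :
    ∑ w, adjacencyMatrix G y w * f (G.dist w z) =
      c G (G.dist y z) * f (G.dist y z - 1) + b G (G.dist y z) * f (G.dist y z + 1) := by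
  have key : ∀ w, adjacencyMatrix G y w * f (G.dist w z) =
      (if G.dist y w = 1 ∧ G.dist w z = G.dist y z - 1 then f (G.dist y z - 1) else 0) +
      (if G.dist y w = 1 ∧ G.dist w z = G.dist y z + 1 then f (G.dist y z + 1) else 0) := by
    intro w
    simp only [adjacencyMatrix, distanceMatrix, Matrix.of_apply]
    by_cases h : G.dist y w = 1
    · rcases dist_of_adj hG.connected hbip z h with h1 | h1
      · have h2 : G.dist w z = G.dist y z - 1 := by omega
        have h3 : ¬ (G.dist y z - 1 = G.dist y z + 1) := by omega
        simp [h, h2, h3]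
      · have h3 : ¬ (G.dist y z + 1 = G.dist y z - 1) := by omega
        simp [h, h1, h3]
    · simp [h]
  rw [Finset.sum_congr rfl fun w _ => key w, Finset.sum_add_distrib]
  simp only [← Finset.sum_filter, Finset.sum_const, nsmul_eq_mul]
  rw [hG.card_eq_intersectionNumber, hG.card_eq_intersectionNumber]
  rfl

theorem intersectionNumber_pos (hG : IsDistanceRegular G) {i j : ℕ} {x y z : X}
    (h1 : G.dist x z = i) (h2 : G.dist z y = j) : 0 < intersectionNumber G (G.dist x y) i j := by
  rw [← hG.card_eq_intersectionNumber]
  exact Finset.card_pos.mpr ⟨z, by simp [h1, h2]⟩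

theorem b_pos (hG : IsDistanceRegular G) {i : ℕ} (hi : i < G.diam) : 0 < b G i := by
  have := hG.connected.nonempty
  obtain ⟨γ, hγ⟩ := exists_geodesic hG.connected
  have h := intersectionNumber_pos hG (x := γ 1) (z := γ 0) (y := γ (i + 1))
    (by rw [G.dist_comm, hγ] <;> omega) (hγ _ _ (by omega) (by omega))
  rwa [hγ _ _ (by omega) (by omega)] at h

theorem c_pos (hG : IsDistanceRegular G) {i : ℕ} (hi : 1 ≤ i) (hi' : i ≤ G.diam) :
    0 < c G i := by
  have := hG.connected.nonempty
  obtain ⟨γ, hγ⟩ := exists_geodesic hG.connected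
  have h := intersectionNumber_pos hG (x := γ 0) (z := γ 1) (y := γ i)
    (hγ _ _ (by omega) (by omega)) (hγ _ _ (by omega) (by omega))
  rwa [hγ _ _ (by omega) (by omega)] at h

/-- Since `0 - 1 = 0` in `ℕ`, this is `p^0_{1,0}`, which still vanishes; the recurrences therefore
hold at distance 0 without a separate case. -/
theorem c_zero (hG : IsDistanceRegular G) : c G 0 = 0 := by
  have := hG.connected.nonempty
  obtain ⟨x⟩ := this
  have h := hG.card_eq_intersectionNumber 1 0 x x
  rw [SimpleGraph.dist_self] at h
  rw [c, ← h, Finset.card_eq_zero, Finset.filter_eq_empty_iff]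
  intro z _ hz
  rw [G.dist_comm] at hz
  omega

theorem c_one (hG : IsDistanceRegular G) (hD : 1 ≤ G.diam) : c G 1 = 1 := by
  have := hG.connected.nonempty
  obtain ⟨γ, hγ⟩ := exists_geodesic hG.connected
  have h01 := hγ 0 1 (by omega) hD
  have h := hG.card_eq_intersectionNumber 1 0 (γ 0) (γ 1)
  rw [h01] at h
  rw [c, ← h, Finset.card_eq_one]
  refine ⟨γ 1, ?_⟩
  ext z
  simp only [Finset.mem_filter, Finset.mem_univ, true_and, Finset.mem_singleton,
    hG.connected.dist_eq_zero_iff]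
  constructor
  · exact fun h => h.2
  · rintro rfl
    exact ⟨h01, rfl⟩

theorem c_add_b (hG : IsDistanceRegular G) (hbip : G.IsBipartite) {i : ℕ} (hi : i ≤ G.diam) :
    c G i + b G i = valency G := by
  have := hG.connected.nonempty
  obtain ⟨γ, hγ⟩ := exists_geodesic hG.connected
  have h1 := sum_adjacencyMatrix_mul hG hbip (fun _ => 1) (γ 0) (γ i)
  have h2 := sum_adjacencyMatrix_mul hG hbip (fun _ => 1) (γ 0) (γ 0)
  rw [hγ 0 i (by omega) hi] at h1
  rw [h1, SimpleGraph.dist_self, c_zero hG] at h2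
  simp only [mul_one] at h2
  have : c G i + b G i = 0 + b G 0 := by exact_mod_cast h2
  rw [this, zero_add, valency]

end Combinatorics

end DRG
namespace DRG

/-! ### Eigenprojections of the adjacency matrix and their cosine sequences. -/

section Spectral

variable {X : Type*} [Fintype X] [DecidableEq X] {G : SimpleGraph X}

theorem act_apply (B : Matrix X X ℂ) (v : EuclideanSpace ℂ X) (y : X) :
    act B v y = ∑ z, B y z * v z := rfl

theorem act_mul (B C : Matrix X X ℂ) (v : EuclideanSpace ℂ X) :
    act (B * C) v = act B (act C v) := by
  ext y
  simp [act, Matrix.toLpLin_apply, Matrix.mulVec_mulVec]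

theorem act_add (B C : Matrix X X ℂ) (v : EuclideanSpace ℂ X) :
    act (B + C) v = act B v + act C v := by
  simp [act]

theorem act_one (v : EuclideanSpace ℂ X) : act 1 v = v := by
  simp [act]

theorem act_smul (a : ℂ) (B : Matrix X X ℂ) (v : EuclideanSpace ℂ X) :
    act (a • B) v = a • act B v := by
  simp [act]

theorem act_injective : Function.Injective (act (X := X)) :=
  Matrix.toEuclideanLin.injective

open Polynomial in
theorem act_aeval (B : Matrix X X ℂ) {v : EuclideanSpace ℂ X} {μ : ℂ} (h : act B v = μ • v)
    (p : ℂ[X]) : act (aeval B p) v = p.eval μ • v := by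
  induction p using Polynomial.induction_on with
  | C a => simp [Algebra.algebraMap_eq_smul_one, act_smul, act_one]
  | add p q hp hq => rw [map_add, act_add, hp, hq, eval_add, add_smul]
  | monomial n a ih =>
    rw [pow_succ, ← mul_assoc, map_mul, act_mul, aeval_X, h, map_smul, ih, smul_smul]
    simp only [eval_mul, eval_X, eval_C, eval_pow]
    congr 1
    ring

theorem isHermitian_adjacencyMatrix {X : Type*} (G : SimpleGraph X) : (adjacencyMatrix G).IsHermitian := by
  ext y z
  rw [Matrix.conjTranspose_apply, adjacencyMatrix, distanceMatrix, Matrix.of_apply,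
    Matrix.of_apply, G.dist_comm]
  split_ifs <;> simp

theorem act_eigenvectorBasis (G : SimpleGraph X) (i : X) :
    act (adjacencyMatrix G) ((isHermitian_adjacencyMatrix G).eigenvectorBasis i) =
      ((isHermitian_adjacencyMatrix G).eigenvalues i : ℂ) •
        (isHermitian_adjacencyMatrix G).eigenvectorBasis i := by
  ext y
  have := congrFun ((isHermitian_adjacencyMatrix G).mulVec_eigenvectorBasis i) y
  simpa [act, Matrix.toLpLin_apply] using this

/-- The matrix of the orthogonal projection onto the `θ`-eigenspace of the adjacency matrix. -/
noncomputable def eigenprojection (G : SimpleGraph X) (θ : ℝ) : Matrix X X ℂ :=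
  Matrix.toEuclideanLin.symm
    (Module.End.eigenspace (act (adjacencyMatrix G)) (θ : ℂ)).starProjection

theorem act_eigenprojection (G : SimpleGraph X) (θ : ℝ) (v : EuclideanSpace ℂ X) :
    act (eigenprojection G θ) v =
      (Module.End.eigenspace (act (adjacencyMatrix G)) (θ : ℂ)).starProjection v := by
  simp [act, eigenprojection]

theorem act_adjacencyMatrix_eigenprojection (G : SimpleGraph X) (θ : ℝ)
    (v : EuclideanSpace ℂ X) :
    act (adjacencyMatrix G) (act (eigenprojection G θ) v) =
      (θ : ℂ) • act (eigenprojection G θ) v := by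
  rw [act_eigenprojection]
  exact Module.End.mem_eigenspace_iff.mp (Submodule.starProjection_apply_mem _ _)

theorem act_isSymmetric {B : Matrix X X ℂ} (hB : B.IsHermitian) : (act B).IsSymmetric :=
  Matrix.isSymmetric_toEuclideanLin_iff.mpr hB

theorem inner_eq_zero_of_eigenvector {θ μ : ℝ} (h : θ ≠ μ) {v w : EuclideanSpace ℂ X}
    (hv : act (adjacencyMatrix G) v = (θ : ℂ) • v)
    (hw : act (adjacencyMatrix G) w = (μ : ℂ) • w) : inner ℂ v w = 0 := by
  have h1 := act_isSymmetric (isHermitian_adjacencyMatrix G) v w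
  rw [hv, hw, inner_smul_left, inner_smul_right, Complex.conj_ofReal] at h1
  have h2 : ((θ : ℂ) - μ) * inner ℂ v w = 0 := by rw [sub_mul, h1, sub_self]
  refine (mul_eq_zero.mp h2).resolve_left ?_
  exact sub_ne_zero.mpr (by exact_mod_cast h)

theorem act_eigenprojection_eq_self {θ : ℝ} {v : EuclideanSpace ℂ X}
    (hv : act (adjacencyMatrix G) v = (θ : ℂ) • v) : act (eigenprojection G θ) v = v := by
  rw [act_eigenprojection, Submodule.starProjection_eq_self_iff]
  exact Module.End.mem_eigenspace_iff.mpr hv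

theorem act_eigenprojection_eq_zero {θ μ : ℝ} (h : θ ≠ μ) {v : EuclideanSpace ℂ X}
    (hv : act (adjacencyMatrix G) v = (μ : ℂ) • v) : act (eigenprojection G θ) v = 0 := by
  rw [act_eigenprojection, Submodule.starProjection_apply_eq_zero_iff, Submodule.mem_orthogonal]
  intro u hu
  exact inner_eq_zero_of_eigenvector h (Module.End.mem_eigenspace_iff.mp hu) hv

/-- Interpolate the indicator of `θ` on the spectrum and compare on an eigenbasis; if `θ` is not an
eigenvalue, both sides are zero. -/
theorem eigenprojection_eq_aeval (G : SimpleGraph X) (θ : ℝ) :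
    ∃ p : Polynomial ℂ, eigenprojection G θ = Polynomial.aeval (adjacencyMatrix G) p := by
  classical
  set hA := isHermitian_adjacencyMatrix G
  refine ⟨Lagrange.interpolate (Finset.univ.image hA.eigenvalues) (fun μ : ℝ => (μ : ℂ))
    (fun μ => if μ = θ then 1 else 0), act_injective ?_⟩
  refine hA.eigenvectorBasis.toBasis.ext fun i => ?_
  rw [OrthonormalBasis.coe_toBasis, act_aeval _ (act_eigenvectorBasis G i),
    Lagrange.eval_interpolate_at_node (v := fun μ : ℝ => (μ : ℂ)) _
      (Complex.ofReal_injective.injOn) (Finset.mem_image_of_mem _ (Finset.mem_univ i))]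
  split_ifs with h
  · rw [one_smul]
    exact act_eigenprojection_eq_self (by rw [← h]; exact act_eigenvectorBasis G i)
  · rw [zero_smul]
    exact act_eigenprojection_eq_zero (Ne.symm h) (act_eigenvectorBasis G i)

theorem exists_aeval_apply_eq_dist (hG : IsDistanceRegular G) (hbip : G.IsBipartite)
    (p : Polynomial ℂ) :
    ∃ q : ℕ → ℂ, ∀ y z, Polynomial.aeval (adjacencyMatrix G) p y z = q (G.dist y z) := by
  induction p using Polynomial.induction_on with
  | C a =>
    refine ⟨fun h => if h = 0 then a else 0, fun y z => ?_⟩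
    simp [Matrix.algebraMap_matrix_apply, hG.connected.dist_eq_zero_iff]
  | add p q hp hq =>
    obtain ⟨f, hf⟩ := hp
    obtain ⟨g, hg⟩ := hq
    exact ⟨fun h => f h + g h, fun y z => by simp [hf, hg]⟩
  | monomial n a ih =>
    obtain ⟨f, hf⟩ := ih
    refine ⟨fun h => c G h * f (h - 1) + b G h * f (h + 1), fun y z => ?_⟩
    rw [pow_succ', mul_left_comm, map_mul, Polynomial.aeval_X, Matrix.mul_apply]
    refine Eq.trans ?_ (sum_adjacencyMatrix_mul hG hbip f y z)
    exact Finset.sum_congr rfl fun w _ => by rw [hf]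

theorem trace_eigenprojection (G : SimpleGraph X) (θ : ℝ) :
    (eigenprojection G θ).trace = (eigenprojection G θ).rank := by
  set U := Module.End.eigenspace (act (adjacencyMatrix G)) (θ : ℂ)
  have h1 : (eigenprojection G θ).trace =
      LinearMap.trace ℂ _ (U.starProjection : EuclideanSpace ℂ X →ₗ[ℂ] EuclideanSpace ℂ X) := by
    rw [← Matrix.trace_toLin_eq (eigenprojection G θ) (PiLp.basisFun 2 ℂ X)]
    congr 1
    rw [← Matrix.toLpLin_eq_toLin]
    simp [eigenprojection, U]
  have h2 : (eigenprojection G θ).rank = Module.finrank ℂ U := by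
    rw [Matrix.rank_eq_finrank_range_toLin _ (PiLp.basisFun 2 ℂ X) (PiLp.basisFun 2 ℂ X),
      ← Matrix.toLpLin_eq_toLin]
    have : (Matrix.toLpLin 2 2 (eigenprojection G θ)) =
      (U.starProjection : EuclideanSpace ℂ X →ₗ[ℂ] EuclideanSpace ℂ X) := by
        simp [eigenprojection, U]
    rw [this]
    exact congrArg (fun V : Submodule ℂ (EuclideanSpace ℂ X) => Module.finrank ℂ V)
      U.range_starProjection
  rw [h1, h2]
  refine LinearMap.IsProj.trace (p := U) ⟨fun v => U.starProjection_apply_mem v, fun v hv => ?_⟩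
  exact Submodule.starProjection_eq_self_iff.mpr hv

/-- The entries of the eigenprojection are the values of the (scaled) cosine sequence. -/
theorem exists_cosine (hG : IsDistanceRegular G) (hbip : G.IsBipartite) (θ : ℝ) :
    ∃ q : ℕ → ℂ, (∀ y z, eigenprojection G θ y z = q (G.dist y z)) ∧
      Fintype.card X * q 0 = (eigenprojection G θ).rank ∧
      ∀ h ≤ G.diam, c G h * q (h - 1) + b G h * q (h + 1) = θ * q h := by
  obtain ⟨p, hp⟩ := eigenprojection_eq_aeval G θ
  obtain ⟨q, hq⟩ := exists_aeval_apply_eq_dist hG hbip p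
  rw [← hp] at hq
  have := hG.connected.nonempty
  obtain ⟨γ, hγ⟩ := exists_geodesic hG.connected
  refine ⟨q, hq, ?_, fun h hh => ?_⟩
  · rw [← trace_eigenprojection, Matrix.trace]
    simp [hq]
  -- The recurrence is this identity read at the entry `(γ 0, γ h)`.
  · have h1 : adjacencyMatrix G * eigenprojection G θ = (θ : ℂ) • eigenprojection G θ := by
      refine act_injective (LinearMap.ext fun v => ?_)
      rw [act_mul, act_smul, act_adjacencyMatrix_eigenprojection]
    have h2 := congrFun (congrFun h1 (γ 0)) (γ h)
    rw [Matrix.mul_apply] at h2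
    simp only [hq, Matrix.smul_apply, smul_eq_mul] at h2
    rw [sum_adjacencyMatrix_mul hG hbip] at h2
    rwa [hγ 0 h (by omega) hh] at h2

theorem mem_spectrum_iff (G : SimpleGraph X) (θ : ℝ) :
    θ ∈ spectrum ℝ (adjacencyMatrix G) ↔
      ∃ v ≠ 0, act (adjacencyMatrix G) v = (θ : ℂ) • v := by
  set hA := isHermitian_adjacencyMatrix G
  rw [hA.spectrum_real_eq_range_eigenvalues]
  constructor
  · rintro ⟨i, rfl⟩
    exact ⟨hA.eigenvectorBasis i, hA.eigenvectorBasis.toBasis.ne_zero i, act_eigenvectorBasis G i⟩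
  · rintro ⟨v, hv0, hv⟩
    by_contra h
    apply hv0
    rw [← hA.eigenvectorBasis.sum_repr' v]
    refine Finset.sum_eq_zero fun i _ => ?_
    rw [inner_eq_zero_of_eigenvector (fun he => h ⟨i, he⟩) (act_eigenvectorBasis G i) hv,
      zero_smul]

/-- A quadratic form comparison produces an eigenvector that is not orthogonal to the vector. -/
theorem exists_eigenvector_of_norm_act (G : SimpleGraph X) (v : EuclideanSpace ℂ X) (β ε : ℝ)
    (h : 0 < ε * (‖act (adjacencyMatrix G) v‖ ^ 2 - β * ‖v‖ ^ 2)) :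
    ∃ (θ : ℝ) (w : EuclideanSpace ℂ X), act (adjacencyMatrix G) w = (θ : ℂ) • w ∧
      inner ℂ w v ≠ 0 ∧ 0 < ε * (θ ^ 2 - β) := by
  set hA := isHermitian_adjacencyMatrix G
  set e := hA.eigenvectorBasis
  by_contra! hcon
  refine absurd h (not_lt.mpr ?_)
  -- By Parseval the quantity is `∑ ε (λ_i² - β) |⟨e_i, v⟩|²`, so if it is positive some term is
  -- positive. The sign `ε` covers both directions of the comparison.
  rw [← e.sum_sq_norm_inner_right v, ← e.sum_sq_norm_inner_right, Finset.mul_sum,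
    ← Finset.sum_sub_distrib, Finset.mul_sum]
  refine Finset.sum_nonpos fun i _ => ?_
  rw [← act_isSymmetric hA, act_eigenvectorBasis, inner_smul_left, Complex.conj_ofReal, norm_mul,
    mul_pow, Complex.norm_real, Real.norm_eq_abs, sq_abs, ← sub_mul, ← mul_assoc]
  by_cases hi : inner ℂ (e i) v = 0
  · simp [e, hi]
  · exact mul_nonpos_of_nonpos_of_nonneg (hcon _ _ (act_eigenvectorBasis G i) hi) (sq_nonneg _)

end Spectral

end DRG
-- Number, order and symmetry of the eigenvalues.
namespace DRG

section Eigenvalues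

variable {X : Type*} [Fintype X] [DecidableEq X] {G : SimpleGraph X}

theorem act_single (B : Matrix X X ℂ) (u y : X) :
    act B (EuclideanSpace.single u 1) y = B y u := by
  simp [act_apply]

theorem dist_le_diam_of_connected {X : Type*} [Finite X] {G : SimpleGraph X} (hG : G.Connected) (u v : X) : G.dist u v ≤ G.diam := by
  have := hG.nonempty
  exact SimpleGraph.dist_le_diam (SimpleGraph.connected_iff_ediam_ne_top.mp hG)

/-- The product of `X - μ` over the spectrum annihilates `A`. If its degree `d` were at most the
diameter, its entry at two vertices at distance `d` would be the number of walks of length `d`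
between them, which is positive, since lower powers of `A` vanish there. -/
theorem diam_lt_card_spectrum (hG : G.Connected) :
    G.diam < (Matrix.finite_real_spectrum (A := adjacencyMatrix G)).toFinset.card := by
  classical
  set S := (Matrix.finite_real_spectrum (A := adjacencyMatrix G)).toFinset with hS
  by_contra! hcard
  have := hG.nonempty
  set hA := isHermitian_adjacencyMatrix G
  set p : Polynomial ℂ := ∏ μ ∈ S, (Polynomial.X - Polynomial.C (μ : ℂ)) with hp
  have hmonic : p.Monic := Polynomial.monic_prod_of_monic _ _ fun μ _ => Polynomial.monic_X_sub_C _
  have hdeg : p.natDegree = S.card := by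
    rw [hp, Polynomial.natDegree_prod_of_monic _ _ fun μ _ => Polynomial.monic_X_sub_C _]
    simp
  have hzero : Polynomial.aeval (adjacencyMatrix G) p = 0 := by
    refine act_injective (hA.eigenvectorBasis.toBasis.ext fun i => ?_)
    rw [OrthonormalBasis.coe_toBasis, act_aeval _ (act_eigenvectorBasis G i), hp,
      Polynomial.eval_prod, Finset.prod_eq_zero (i := hA.eigenvalues i)]
    · simp [act]
    · rw [hS, Set.Finite.mem_toFinset]
      exact hA.eigenvalues_mem_spectrum_real i
    · simp
  obtain ⟨γ, hγ⟩ := exists_geodesic hG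
  have hd := hγ 0 S.card (by omega) hcard
  have hentry := congrFun (congrFun hzero (γ 0)) (γ S.card)
  rw [Polynomial.aeval_eq_sum_range, hdeg, Matrix.sum_apply, Finset.sum_range_succ,
    Finset.sum_eq_zero, zero_add, ← hdeg, hmonic.coeff_natDegree, one_smul, hdeg,
    adjacencyMatrix_eq_adjMatrix, SimpleGraph.adjMatrix_pow_apply_eq_card_walk,
    Matrix.zero_apply, Nat.cast_eq_zero, Fintype.card_eq_zero_iff] at hentry
  · obtain ⟨w, hw⟩ := hG.exists_walk_length_eq_dist (γ 0) (γ S.card)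
    exact hentry.elim ⟨w, by simp [hw, hd]⟩
  · intro i hi
    rw [Matrix.smul_apply, adjacencyMatrix_eq_adjMatrix,
      SimpleGraph.adjMatrix_pow_apply_eq_card_walk, Fintype.card_eq_zero_iff.mpr]
    · simp
    · refine ⟨fun ⟨w, hw⟩ => ?_⟩
      have h1 := SimpleGraph.dist_le w
      have h2 : w.length = i := hw
      have h3 := Finset.mem_range.mp hi
      omega

/-- The vectors `E_θ e_x` are eigenvectors for distinct eigenvalues, hence independent, and all come
from functions of the `D + 1` distances to `x`. -/
theorem card_spectrum_le (hG : IsDistanceRegular G) (hbip : G.IsBipartite) :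
    (Matrix.finite_real_spectrum (A := adjacencyMatrix G)).toFinset.card ≤ G.diam + 1 := by
  set S := (Matrix.finite_real_spectrum (A := adjacencyMatrix G)).toFinset with hS
  choose q hq hq0 hrec using exists_cosine hG hbip
  obtain ⟨x⟩ := hG.connected.nonempty
  let L : (Fin (G.diam + 1) → ℂ) →ₗ[ℂ] (X → ℂ) :=
    LinearMap.funLeft ℂ ℂ fun y : X =>
      ⟨G.dist y x, Nat.lt_succ_of_le (dist_le_diam_of_connected hG.connected y x)⟩
  let e : (X → ℂ) →ₗ[ℂ] EuclideanSpace ℂ X := (WithLp.linearEquiv 2 ℂ (X → ℂ)).symm.toLinearMap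
  let r : S → Fin (G.diam + 1) → ℂ := fun θ h => q θ h
  have key : ∀ θ : S, (e ∘ₗ L) (r θ) =
      act (eigenprojection G θ) (EuclideanSpace.single x 1) := by
    intro θ
    ext y
    rw [act_single, hq]
    rfl
  have hli : LinearIndependent ℂ ((e ∘ₗ L) ∘ r) := by
    refine Module.End.eigenvectors_linearIndependent' (act (adjacencyMatrix G))
      (fun θ : S => ((θ : ℝ) : ℂ)) (fun θ μ h => Subtype.ext (Complex.ofReal_injective h)) _ ?_
    intro θ
    simp only [Function.comp_apply]
    rw [key]
    refine ⟨Module.End.mem_eigenspace_iff.mpr (act_adjacencyMatrix_eigenprojection _ _ _), ?_⟩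
    intro h0
    -- The `x`-coordinate of the column is `q θ 0`; if it were zero, `E_θ` would have rank 0.
    have h1 : q θ 0 = 0 := by
      have := congrArg (fun v : EuclideanSpace ℂ X => v x) h0
      simpa [act_single, hq] using this
    have h2 := hq0 θ
    rw [h1, mul_zero] at h2
    have h3 : (eigenprojection G θ).rank = 0 := by exact_mod_cast h2.symm
    obtain ⟨v, hv0, hv⟩ := (mem_spectrum_iff G θ).mp ((Set.Finite.mem_toFinset _).mp θ.2)
    apply hv0
    rw [Matrix.rank, Submodule.finrank_eq_zero, LinearMap.range_eq_bot] at h3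
    rw [← act_eigenprojection_eq_self hv]
    ext y
    exact congrFun (LinearMap.congr_fun h3 v) y
  have := (LinearIndependent.of_comp _ hli).fintype_card_le_finrank
  simpa using this

theorem card_spectrum (hG : IsDistanceRegular G) (hbip : G.IsBipartite) :
    (Matrix.finite_real_spectrum (A := adjacencyMatrix G)).toFinset.card = G.diam + 1 :=
  le_antisymm (card_spectrum_le hG hbip) (diam_lt_card_spectrum hG.connected)

/-- Flip the sign of an eigenvector on one colour class. -/
theorem neg_mem_spectrum (hbip : G.IsBipartite) {θ : ℝ}
    (h : θ ∈ spectrum ℝ (adjacencyMatrix G)) : -θ ∈ spectrum ℝ (adjacencyMatrix G) := by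
  rw [mem_spectrum_iff] at h ⊢
  obtain ⟨v, hv0, hv⟩ := h
  obtain ⟨c⟩ := exists_coloring_bool hbip
  refine ⟨WithLp.toLp 2 fun y => if c y then v y else - v y, ?_, ?_⟩
  · contrapose! hv0
    ext y
    have := congrArg (fun v : EuclideanSpace ℂ X => v y) hv0
    simp only [PiLp.zero_apply] at this ⊢
    split_ifs at this
    · exact this
    · exact neg_eq_zero.mp this
  · ext y
    have hy := congrArg (fun v : EuclideanSpace ℂ X => v y) hv
    simp only [act_apply, PiLp.smul_apply, smul_eq_mul] at hy ⊢
    have : ∀ z, adjacencyMatrix G y z * (if c z then v z else - v z) =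
        (if c y then -1 else 1) * (adjacencyMatrix G y z * v z) := by
      intro z
      simp only [adjacencyMatrix, distanceMatrix, Matrix.of_apply]
      by_cases h : G.dist y z = 1
      · have := c.valid (SimpleGraph.dist_eq_one_iff_adj.mp h)
        cases h1 : c y <;> cases h2 : c z <;> simp_all
      · simp [h]
    rw [Finset.sum_congr rfl fun z _ => this z, ← Finset.mul_sum, hy]
    push_cast
    split_ifs <;> ring

theorem valency_mem_spectrum (hG : IsDistanceRegular G) (hbip : G.IsBipartite) :
    (valency G : ℝ) ∈ spectrum ℝ (adjacencyMatrix G) := by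
  obtain ⟨x⟩ := hG.connected.nonempty
  rw [mem_spectrum_iff]
  refine ⟨WithLp.toLp 2 fun _ => 1, ?_, ?_⟩
  · intro h
    have := congrArg (fun v : EuclideanSpace ℂ X => v x) h
    simp at this
  · ext y
    have := sum_adjacencyMatrix_mul hG hbip (fun _ => 1) y y
    simp only [SimpleGraph.dist_self, c_zero hG] at this
    simp only [act_apply, PiLp.smul_apply, smul_eq_mul]
    rw [this]
    simp [valency]

theorem eigenvalue_lt (hG : IsDistanceRegular G) (hbip : G.IsBipartite) {i j : ℕ} (hij : i < j)
    (hj : j ≤ G.diam) : eigenvalue G j < eigenvalue G i := by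
  have hlen : ((Matrix.finite_real_spectrum (A := adjacencyMatrix G)).toFinset.sort
      (· ≥ ·)).length = G.diam + 1 := by rw [Finset.length_sort, card_spectrum hG hbip]
  rw [eigenvalue, eigenvalue, List.getD_eq_getElem _ _ (by omega),
    List.getD_eq_getElem _ _ (by omega)]
  exact List.pairwise_iff_getElem.mp (Finset.sortedGT_sort _).pairwise i j (by omega) (by omega) hij

theorem mem_spectrum_iff_exists_eigenvalue (hG : IsDistanceRegular G) (hbip : G.IsBipartite)
    {θ : ℝ} : θ ∈ spectrum ℝ (adjacencyMatrix G) ↔ ∃ i ≤ G.diam, eigenvalue G i = θ := by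
  have hlen : ((Matrix.finite_real_spectrum (A := adjacencyMatrix G)).toFinset.sort
      (· ≥ ·)).length = G.diam + 1 := by rw [Finset.length_sort, card_spectrum hG hbip]
  rw [← Set.Finite.mem_toFinset (Matrix.finite_real_spectrum (A := adjacencyMatrix G)),
    ← Finset.mem_sort (· ≥ ·), List.mem_iff_getElem]
  constructor
  · rintro ⟨i, hi, rfl⟩
    exact ⟨i, by omega, by rw [eigenvalue, List.getD_eq_getElem]⟩
  · rintro ⟨i, hi, rfl⟩
    exact ⟨i, by omega, by rw [eigenvalue, List.getD_eq_getElem]⟩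

/-- The spectrum is symmetric, so `θ_i` and `-θ_{D-i}` are two strictly decreasing enumerations of
the same finite set, hence equal. -/
theorem eigenvalue_diam_sub (hG : IsDistanceRegular G) (hbip : G.IsBipartite) {i : ℕ}
    (hi : i ≤ G.diam) : eigenvalue G (G.diam - i) = - eigenvalue G i := by
  have hanti : StrictAnti fun i : Fin (G.diam + 1) => eigenvalue G i :=
    fun i j hij => eigenvalue_lt hG hbip hij (by omega)
  have hanti' : StrictAnti fun i : Fin (G.diam + 1) => - eigenvalue G (Fin.rev i) :=
    fun i j hij => neg_lt_neg (hanti (Fin.rev_lt_rev.mpr hij))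
  have hrange : Set.range (fun i : Fin (G.diam + 1) => eigenvalue G i) =
      Set.range fun i : Fin (G.diam + 1) => - eigenvalue G (Fin.rev i) := by
    ext θ
    have h1 : ∀ θ, θ ∈ Set.range (fun i : Fin (G.diam + 1) => eigenvalue G i) ↔
        θ ∈ spectrum ℝ (adjacencyMatrix G) := fun θ => by
      rw [mem_spectrum_iff_exists_eigenvalue hG hbip]
      exact ⟨fun ⟨i, h⟩ => ⟨i, by omega, h⟩, fun ⟨i, hi, h⟩ => ⟨⟨i, by omega⟩, h⟩⟩
    have h2 : θ ∈ (Set.range fun i : Fin (G.diam + 1) => - eigenvalue G (Fin.rev i)) ↔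
        -θ ∈ Set.range (fun i : Fin (G.diam + 1) => eigenvalue G i) :=
      ⟨fun ⟨i, h⟩ => ⟨Fin.rev i, by simp [← h]⟩, fun ⟨i, h⟩ => ⟨Fin.rev i, by simp at h ⊢; simp [h]⟩⟩
    rw [h2, h1, h1]
    exact ⟨neg_mem_spectrum hbip, fun h => by simpa using neg_mem_spectrum hbip h⟩
  have := congrFun (hanti.range_inj hanti' |>.mp hrange) ⟨i, by omega⟩
  simp only [Fin.val_rev] at this
  rw [this, neg_neg]
  congr 1
  omega

end Eigenvalues

end DRG
-- Comparison of `θ_n²` with `b_2`.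
namespace DRG

section Bounds

variable {X : Type*} [Fintype X] [DecidableEq X] {G : SimpleGraph X}

/-- This is the entry `(A²)_{uv}`: `k` at distance 0, `c_2` at distance 2, and 0 otherwise. -/
theorem inner_act_adjacencyMatrix_single (hG : IsDistanceRegular G) (hbip : G.IsBipartite)
    (u v : X) :
    inner ℂ (act (adjacencyMatrix G) (EuclideanSpace.single u 1))
        (act (adjacencyMatrix G) (EuclideanSpace.single v 1)) =
      c G (G.dist u v) * (if G.dist u v - 1 = 1 then 1 else 0) +
        b G (G.dist u v) * (if G.dist u v + 1 = 1 then 1 else 0) := by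
  rw [act_isSymmetric (isHermitian_adjacencyMatrix G), EuclideanSpace.inner_single_left, map_one,
    one_mul, act_apply, ← sum_adjacencyMatrix_mul hG hbip fun h => if h = 1 then 1 else 0]
  refine Finset.sum_congr rfl fun w _ => ?_
  rw [act_single]
  rfl

theorem cosine_eq {X : Type*} [Fintype X] {G : SimpleGraph X} (hG : IsDistanceRegular G) (hbip : G.IsBipartite) {q : ℕ → ℂ} {s : ℂ}
    (hs : s ^ 2 = 1)
    (hq : ∀ h ≤ G.diam, c G h * q (h - 1) + b G h * q (h + 1) = (s * valency G) * q h) :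
    ∀ h ≤ G.diam, q h = s ^ h * q 0 := by
  intro h
  induction h using Nat.strong_induction_on with
  | _ h ih =>
    intro hh
    rcases h with _ | h
    · simp
    have h1 := hq h (by omega)
    have h2 : (b G h : ℂ) ≠ 0 := by exact_mod_cast (b_pos hG (i := h) (by omega)).ne'
    have h3 : (c G h : ℂ) + b G h = valency G := by
      exact_mod_cast c_add_b hG hbip (i := h) (by omega)
    apply mul_left_cancel₀ h2
    rw [ih h (by omega) (by omega), ← h3] at h1
    rcases h with _ | h
    · rw [c_zero hG] at h1
      push_cast at h1
      linear_combination h1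
    · rw [Nat.add_sub_cancel, ih h (by omega) (by omega)] at h1
      linear_combination h1 + (c G (h + 1) : ℂ) * s ^ h * q 0 * hs

/-- For `θ = ±k` the entries of the projection are `(±1)^∂ q 0` and depend only on parity, so its
rows at `u` and `v` coincide. -/
theorem eigenvector_apply_eq (hG : IsDistanceRegular G) (hbip : G.IsBipartite) {θ : ℝ}
    (hθ : θ ^ 2 = (valency G : ℝ) ^ 2) {w : EuclideanSpace ℂ X}
    (hw : act (adjacencyMatrix G) w = (θ : ℂ) • w) {u v : X} (huv : Even (G.dist u v)) :
    w u = w v := by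
  obtain ⟨q, hq, -, hrec⟩ := exists_cosine hG hbip θ
  obtain ⟨s, hs, hs'⟩ : ∃ s : ℂ, s ^ 2 = 1 ∧ (θ : ℂ) = s * valency G := by
    rcases sq_eq_sq_iff_eq_or_eq_neg.mp hθ with h | h
    · exact ⟨1, by simp, by simp [h]⟩
    · exact ⟨-1, by simp, by simp [h]⟩
  rw [hs'] at hrec
  have hc := cosine_eq hG hbip hs hrec
  obtain ⟨col⟩ := exists_coloring_bool hbip
  rw [← act_eigenprojection_eq_self hw, act_apply, act_apply]
  refine Finset.sum_congr rfl fun z _ => ?_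
  rw [hq, hq, hc _ (dist_le_diam_of_connected hG.connected u z),
    hc _ (dist_le_diam_of_connected hG.connected v z)]
  have h1 : Even (G.dist u z) ↔ Even (G.dist v z) := by
    rw [even_dist_iff hG.connected col] at huv ⊢
    rw [even_dist_iff hG.connected col, huv]
  congr 2
  rcases Nat.even_or_odd (G.dist u z) with h | h
  · obtain ⟨i, hi⟩ := h.two_dvd
    obtain ⟨j, hj⟩ := (h1.mp h).two_dvd
    rw [hi, hj, pow_mul, pow_mul, hs, one_pow, one_pow]
  · obtain ⟨i, hi⟩ := h
    obtain ⟨j, hj⟩ : Odd (G.dist v z) := by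
      rw [← Nat.not_even_iff_odd, ← h1, Nat.not_even_iff_odd]
      exact ⟨i, hi⟩
    rw [hi, hj, pow_succ, pow_succ, pow_mul, pow_mul, hs, one_pow, one_pow]

theorem norm_sq_eq_of_inner {X : Type*} [Fintype X] {v : EuclideanSpace ℂ X} {r : ℝ} (h : inner ℂ v v = (r : ℂ)) :
    ‖v‖ ^ 2 = r := by
  rw [inner_self_eq_norm_sq_to_K] at h
  refine Complex.ofReal_injective (Eq.trans ?_ h)
  exact Complex.ofReal_pow _ _

/-- The vector `f = e_{γ 0} - e_{γ 4}` has `‖Af‖² = 2k > b_2 ‖f‖²`, and it is orthogonal to the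
`±k`-eigenspaces, whose elements are constant on each colour class. So some eigenvalue other than
`±k` has square above `b_2`. -/
theorem b_lt_eigenvalue_one_sq (hG : IsDistanceRegular G) (hbip : G.IsBipartite)
    (hD : 4 ≤ G.diam) : (b G 2 : ℝ) < eigenvalue G 1 ^ 2 := by
  have := hG.connected.nonempty
  obtain ⟨γ, hγ⟩ := exists_geodesic hG.connected
  have h04 : G.dist (γ 0) (γ 4) = 4 := hγ 0 4 (by omega) hD
  have h40 : G.dist (γ 4) (γ 0) = 4 := by rw [G.dist_comm, h04]
  have hne : γ 0 ≠ γ 4 := fun h => by simp [h] at h04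
  set k := valency G with hk
  have hbk : (b G 2 : ℝ) < k := by
    have h1 := c_add_b hG hbip (i := 2) (by omega)
    have h2 := c_pos hG (i := 2) (by omega) (by omega)
    exact_mod_cast (by omega : b G 2 < k)
  set f : EuclideanSpace ℂ X := EuclideanSpace.single (γ 0) 1 - EuclideanSpace.single (γ 4) 1
  have hf : ‖f‖ ^ 2 = 2 := by
    apply norm_sq_eq_of_inner
    simp only [f, inner_sub_left, inner_sub_right]
    simp [EuclideanSpace.inner_single_left, hne, hne.symm]
    norm_num
  have hAf : ‖act (adjacencyMatrix G) f‖ ^ 2 = 2 * k := by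
    apply norm_sq_eq_of_inner
    simp only [f, map_sub, inner_sub_left, inner_sub_right,
      inner_act_adjacencyMatrix_single hG hbip, h04, h40, SimpleGraph.dist_self]
    simp [hk, valency]
    ring
  obtain ⟨θ, w, hw, hwf, hθ⟩ := exists_eigenvector_of_norm_act G f (b G 2) 1
    (by rw [hf, hAf]; linarith)
  have hw0 : w ≠ 0 := fun h => hwf (by simp [h])
  have hθk : θ ^ 2 ≠ (k : ℝ) ^ 2 := by
    intro h
    apply hwf
    have := eigenvector_apply_eq hG hbip h hw (u := γ 0) (v := γ 4) (by rw [h04]; decide)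
    simp [f, EuclideanSpace.inner_single_right, this]
  have hmem : |θ| ∈ spectrum ℝ (adjacencyMatrix G) := by
    have h1 := (mem_spectrum_iff G θ).mpr ⟨w, hw0, hw⟩
    rcases abs_choice θ with h | h <;> rw [h]
    · exact h1
    · exact neg_mem_spectrum hbip h1
  have hkmem : (k : ℝ) ∈ spectrum ℝ (adjacencyMatrix G) := valency_mem_spectrum hG hbip
  obtain ⟨i, hi, hi'⟩ := (mem_spectrum_iff_exists_eigenvalue hG hbip).mp hmem
  obtain ⟨j, hj, hj'⟩ := (mem_spectrum_iff_exists_eigenvalue hG hbip).mp hkmem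
  have hij : i ≠ j := by
    rintro rfl
    apply hθk
    rw [← hj', hi', sq_abs]
  have hle : ∀ l, 1 ≤ l → l ≤ G.diam → eigenvalue G l ≤ eigenvalue G 1 := by
    intro l hl hl'
    rcases hl.eq_or_lt with rfl | h
    · exact le_rfl
    · exact (eigenvalue_lt hG hbip h hl').le
  have hb0 : (0 : ℝ) ≤ b G 2 := Nat.cast_nonneg _
  by_cases hi0 : 1 ≤ i
  · have h1 := hle i hi0 hi
    rw [hi'] at h1
    have h2 := pow_le_pow_left₀ (abs_nonneg θ) h1 2
    rw [sq_abs] at h2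
    linarith
  -- Here `|θ| = θ_0`, so `k` has index at least 1 and `b_2 < k ≤ k² ≤ θ_1²`; no identification of
  -- `k` with `θ_0` is needed.
  · have h1 := hle j (by omega) hj
    rw [hj'] at h1
    have h2 := pow_le_pow_left₀ (Nat.cast_nonneg _) h1 2
    have h3 : (1 : ℝ) ≤ k := by
      have h4 := c_add_b hG hbip (i := 2) (by omega)
      have h5 := c_pos hG (i := 2) (by omega) (by omega)
      exact_mod_cast (by omega : 1 ≤ k)
    nlinarith

/-- The alternating vector `f = e_{γ 0} - e_{γ 2} + e_{γ 4}` has `‖Af‖² = 3k - 4c_2 < 3(k - c_2) =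
b_2 ‖f‖²`, so some eigenvalue has square below `b_2`. -/
theorem eigenvalue_sq_lt_b (hG : IsDistanceRegular G) (hbip : G.IsBipartite)
    (hD : 4 ≤ G.diam) (hodd : Odd G.diam) : eigenvalue G (G.diam / 2) ^ 2 < (b G 2 : ℝ) := by
  have := hG.connected.nonempty
  obtain ⟨γ, hγ⟩ := exists_geodesic hG.connected
  have h04 : G.dist (γ 0) (γ 4) = 4 := hγ 0 4 (by omega) hD
  have h40 : G.dist (γ 4) (γ 0) = 4 := by rw [G.dist_comm, h04]
  have h02 : G.dist (γ 0) (γ 2) = 2 := hγ 0 2 (by omega) (by omega)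
  have h20 : G.dist (γ 2) (γ 0) = 2 := by rw [G.dist_comm, h02]
  have h24 : G.dist (γ 2) (γ 4) = 2 := hγ 2 4 (by omega) (by omega)
  have h42 : G.dist (γ 4) (γ 2) = 2 := by rw [G.dist_comm, h24]
  have hne : γ 0 ≠ γ 4 := fun h => by simp [h] at h04
  have hne2 : γ 0 ≠ γ 2 := fun h => by simp [h] at h02
  have hne4 : γ 2 ≠ γ 4 := fun h => by simp [h] at h24
  have hbk : (c G 2 : ℝ) + b G 2 = valency G := by
    exact_mod_cast c_add_b hG hbip (i := 2) (by omega)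
  have hc : (0 : ℝ) < c G 2 := by exact_mod_cast c_pos hG (i := 2) (by omega) (by omega)
  set f : EuclideanSpace ℂ X := EuclideanSpace.single (γ 0) 1 - EuclideanSpace.single (γ 2) 1 +
    EuclideanSpace.single (γ 4) 1
  have hf : ‖f‖ ^ 2 = 3 := by
    apply norm_sq_eq_of_inner
    simp only [f, inner_sub_left, inner_sub_right, inner_add_left, inner_add_right]
    simp [EuclideanSpace.inner_single_left, hne, hne.symm, hne2, hne2.symm, hne4, hne4.symm]
    norm_num
  have hAf : ‖act (adjacencyMatrix G) f‖ ^ 2 = 3 * valency G - 4 * c G 2 := by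
    apply norm_sq_eq_of_inner
    simp only [f, map_sub, map_add, inner_sub_left, inner_sub_right, inner_add_left,
      inner_add_right, inner_act_adjacencyMatrix_single hG hbip, h04, h40, h02, h20, h24, h42,
      SimpleGraph.dist_self]
    simp [valency]
    ring
  obtain ⟨θ, w, hw, hwf, hθ⟩ := exists_eigenvector_of_norm_act G f (b G 2) (-1)
    (by rw [hf, hAf]; linarith)
  have hw0 : w ≠ 0 := fun h => hwf (by simp [h])
  obtain ⟨i, hi, hi'⟩ := (mem_spectrum_iff_exists_eigenvalue hG hbip).mp
    ((mem_spectrum_iff G θ).mpr ⟨w, hw0, hw⟩)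
  obtain ⟨d, hd⟩ := hodd
  have hd2 : G.diam / 2 = d := by omega
  rw [hd2]
  -- With `D = 2d + 1`, `θ_{d+1} = -θ_d < θ_d`, so `θ_d` is positive and is the least absolute value
  -- of an eigenvalue.
  have h1 := eigenvalue_diam_sub hG hbip (i := d) (by omega)
  have h2 : eigenvalue G (G.diam - d) < eigenvalue G d := eigenvalue_lt hG hbip (by omega) (by omega)
  have h3 : eigenvalue G d ≤ |θ| := by
    rw [le_abs]
    rcases Nat.lt_or_ge d i with h | h
    · right
      rw [← hi', le_neg, ← h1]
      rcases (by omega : G.diam - d = i ∨ G.diam - d < i) with h | h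
      · rw [h]
      · exact (eigenvalue_lt hG hbip h hi).le
    · left
      rw [← hi']
      rcases h.eq_or_lt with h | h
      · rw [h]
      · exact (eigenvalue_lt hG hbip h (by omega)).le
  have h4 := pow_le_pow_left₀ (by linarith) h3 2
  rw [sq_abs] at h4
  linarith

theorem eigenvalue_sq_ne_b (hG : IsDistanceRegular G) (hbip : G.IsBipartite)
    (hD : 4 ≤ G.diam) {n : ℕ} (hn : n = 1 ∨ (Odd G.diam ∧ n = G.diam / 2)) :
    eigenvalue G n ^ 2 - (b G 2 : ℝ) ≠ 0 := by
  rcases hn with rfl | ⟨hodd, rfl⟩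
  · exact (sub_pos.mpr (b_lt_eigenvalue_one_sq hG hbip hD)).ne'
  · exact (sub_neg.mpr (eigenvalue_sq_lt_b hG hbip hD hodd)).ne

end Bounds

/-! ### Distance-dependent matrices acting on vectors of `E*_2 W`. -/

section Endpoint

variable {X : Type*} [Fintype X] [DecidableEq X] {G : SimpleGraph X}

theorem dualIdempotent_apply (x : X) (i : ℕ) (v : EuclideanSpace ℂ X) (y : X) :
    act (dualIdempotent G x i) v y = if G.dist x y = i then v y else 0 := by
  simp [act, Matrix.toLpLin_apply, dualIdempotent, Matrix.mulVec_diagonal]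

theorem apply_eq_zero_of_mem_dualComponent {x : X} {i : ℕ}
    {W : Submodule ℂ (EuclideanSpace ℂ X)} {v : EuclideanSpace ℂ X}
    (hv : v ∈ dualComponent G x i W) {y : X} (hy : G.dist x y ≠ i) : v y = 0 := by
  obtain ⟨w, -, rfl⟩ := hv
  rw [dualIdempotent_apply, if_neg hy]

/-- Nonzero endpoint makes every vector of `W` vanish at `x`, while the `x`-coordinate of `A²v` is
`c_2 ∑ v_y`. -/
theorem sum_eq_zero_of_endpoint (hG : IsDistanceRegular G) (hbip : G.IsBipartite)
    (hD : 2 ≤ G.diam) {x : X} {W : Submodule ℂ (EuclideanSpace ℂ X)} (hW : IsTModule G x W)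
    (hend : endpoint G x W ≠ 0) {v : EuclideanSpace ℂ X} (hv : v ∈ dualComponent G x 2 W) :
    ∑ y, v y = 0 := by
  have hbot : dualComponent G x 0 W = ⊥ := by
    by_contra h
    exact hend (Nat.le_zero.mp (Nat.sInf_le ⟨Nat.zero_le _, h⟩))
  have hx : ∀ w ∈ W, w x = 0 := by
    intro w hw
    have h1 : act (dualIdempotent G x 0) w ∈ dualComponent G x 0 W := ⟨w, hw, rfl⟩
    rw [hbot, Submodule.mem_bot] at h1
    have := congrArg (fun u : EuclideanSpace ℂ X => u x) h1
    simpa [dualIdempotent_apply] using this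
  have hA : adjacencyMatrix G ∈ subconstituentAlgebra G x :=
    (le_sup_left : boseMesnerAlgebra G ≤ _) (Algebra.self_mem_adjoin_singleton _ _)
  have hE : dualIdempotent G x 2 ∈ subconstituentAlgebra G x :=
    (le_sup_right : dualBoseMesnerAlgebra G x ≤ _) (Algebra.subset_adjoin ⟨2, rfl⟩)
  have hvW : v ∈ W := by
    obtain ⟨w, hw, rfl⟩ := hv
    exact hW _ hE w hw
  have h1 := hx _ (hW _ (mul_mem hA hA) v hvW)
  rw [act_apply] at h1
  have h2 : ∀ y, (adjacencyMatrix G * adjacencyMatrix G) x y * v y = c G 2 * v y := by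
    intro y
    by_cases hy : G.dist x y = 2
    · have := sum_adjacencyMatrix_mul hG hbip (fun h => if h = 1 then 1 else 0) x y
      rw [hy] at this
      rw [Matrix.mul_apply]
      congr 1
      refine Eq.trans ?_ (this.trans (by simp))
      rfl
    · rw [apply_eq_zero_of_mem_dualComponent hv hy, mul_zero, mul_zero]
  rw [Finset.sum_congr rfl fun y _ => h2 y, ← Finset.mul_sum] at h1
  refine (mul_eq_zero.mp h1).resolve_left ?_
  exact Nat.cast_ne_zero.mpr (c_pos hG (i := 2) (by omega) hD).ne'

/-- A matrix with entries depending only on distance acts on a `E₂*`-supported vector orthogonal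
to the all-ones vector through the local eigenvalue alone. -/
theorem act_apply_of_hasLocalEigenvalue (hG : IsDistanceRegular G) (hbip : G.IsBipartite) {x : X}
    {W : Submodule ℂ (EuclideanSpace ℂ X)} {η : ℝ} (hη : HasLocalEigenvalue G x W η)
    {v : EuclideanSpace ℂ X} (hv : v ∈ dualComponent G x 2 W) (hsum : ∑ y, v y = 0)
    {B : Matrix X X ℂ} {q : ℕ → ℂ} (hB : ∀ y z, B y z = q (G.dist y z)) {y : X}
    (hy : G.dist x y = 2) :
    act B v y = (q 0 + η * q 2 - (1 + η) * q 4) * v y := by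
  obtain ⟨col⟩ := exists_coloring_bool hbip
  have hloc : ∑ z, distanceMatrix G 2 y z * v z = η * v y := by
    have h1 := congrArg (fun u : EuclideanSpace ℂ X => u y) (hη v hv)
    simp only [act_mul, dualIdempotent_apply, hy, if_true, PiLp.smul_apply, smul_eq_mul] at h1
    rw [← h1, act_apply]
    refine Finset.sum_congr rfl fun z _ => ?_
    rw [dualIdempotent_apply]
    split_ifs with h
    · rfl
    · rw [apply_eq_zero_of_mem_dualComponent hv h]
  -- Only distances 0, 2, 4 occur between `y` and the support of `v`, so there `B` agrees with `(q 0
  -- - q 4) I + (q 2 - q 4) A_2 + q 4 J`, and `J` kills `v`.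
  have key : ∀ z, B y z * v z = (q 0 - q 4) * ((if y = z then 1 else 0) * v z) +
      (q 2 - q 4) * (distanceMatrix G 2 y z * v z) + q 4 * v z := by
    intro z
    by_cases hz : G.dist x z = 2
    · have h1 : Even (G.dist y z) := by
        have e1 : Even (G.dist x y) := by rw [hy]; decide
        have e2 : Even (G.dist x z) := by rw [hz]; decide
        rw [even_dist_iff hG.connected col] at e1 e2 ⊢
        rw [← e1, e2]
      have h2 := hG.connected.dist_triangle (u := y) (v := x) (w := z)
      rw [G.dist_comm (u := y) (v := x), hy, hz] at h2
      rw [hB, distanceMatrix, Matrix.of_apply]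
      obtain h | h | h : G.dist y z = 0 ∨ G.dist y z = 2 ∨ G.dist y z = 4 := by
        obtain ⟨m, hm⟩ := h1
        omega
      · rw [h, if_pos (hG.connected.dist_eq_zero_iff.mp h)]
        simp
        ring
      · have : y ≠ z := fun e => by simp [e] at h
        simp [h, this]
        ring
      · have : y ≠ z := fun e => by simp [e] at h
        simp [h, this]
    · rw [apply_eq_zero_of_mem_dualComponent hv hz]
      simp
  rw [act_apply, Finset.sum_congr rfl fun z _ => key z, Finset.sum_add_distrib,
    Finset.sum_add_distrib, ← Finset.mul_sum, ← Finset.mul_sum, ← Finset.mul_sum, hloc, hsum]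
  simp only [ite_mul, one_mul, zero_mul, Finset.sum_ite_eq, Finset.mem_univ, if_true]
  ring

theorem norm_act_eigenprojection_sq (θ : ℝ) (v : EuclideanSpace ℂ X) :
    (‖act (eigenprojection G θ) v‖ ^ 2 : ℂ) = inner ℂ v (act (eigenprojection G θ) v) := by
  set U := Module.End.eigenspace (act (adjacencyMatrix G)) (θ : ℂ)
  rw [act_eigenprojection, ← Submodule.inner_starProjection_left_eq_right,
    ← Submodule.starProjection_eq_self_iff.mpr (Submodule.starProjection_apply_mem U v),
    Submodule.inner_starProjection_left_eq_right,
    Submodule.starProjection_eq_self_iff.mpr (Submodule.starProjection_apply_mem U v),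
    inner_self_eq_norm_sq_to_K]
  rfl

end Endpoint

end DRG
-- The norm formula.
namespace DRG

section Norm

variable {X : Type*} [Fintype X] [DecidableEq X] {G : SimpleGraph X}

theorem norm_act_eigenprojection_sq_of_tilde (hG : IsDistanceRegular G) (hbip : G.IsBipartite)
    (hD : 4 ≤ G.diam) {x : X} {W : Submodule ℂ (EuclideanSpace ℂ X)} (hW : IsTModule G x W)
    (hend : endpoint G x W ≠ 0) {τ : ℝ} (hτ : τ ^ 2 - (b G 2 : ℝ) ≠ 0)
    (hη : HasLocalEigenvalue G x W (tilde G τ)) {v : EuclideanSpace ℂ X}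
    (hv : v ∈ dualComponent G x 2 W) (θ : ℝ) :
    ‖act (eigenprojection G θ) v‖ ^ 2 =
      ((eigenprojection G θ).rank : ℝ) * (θ ^ 2 - (valency G : ℝ) ^ 2) * (θ ^ 2 - τ ^ 2) /
        ((Fintype.card X : ℝ) * valency G * b G 1 * (τ ^ 2 - b G 2)) * ‖v‖ ^ 2 := by
  obtain ⟨q, hq, hq0, hrec⟩ := exists_cosine hG hbip θ
  have hsum := sum_eq_zero_of_endpoint hG hbip (by omega) hW hend hv
  set η := tilde G τ with hηdef
  have hinner : (‖act (eigenprojection G θ) v‖ ^ 2 : ℂ) =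
      (q 0 + η * q 2 - (1 + η) * q 4) * (‖v‖ ^ 2 : ℂ) := by
    have hvv : (‖v‖ ^ 2 : ℂ) = inner ℂ v v := (inner_self_eq_norm_sq_to_K v).symm
    rw [norm_act_eigenprojection_sq, hvv, PiLp.inner_apply, PiLp.inner_apply, Finset.mul_sum]
    refine Finset.sum_congr rfl fun y _ => ?_
    by_cases hy : G.dist x y = 2
    · rw [act_apply_of_hasLocalEigenvalue hG hbip hη hv hsum hq hy, ← smul_eq_mul,
        inner_smul_right]
    · rw [apply_eq_zero_of_mem_dualComponent hv hy]
      simp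
  have r0 := hrec 0 (by omega)
  have r1 := hrec 1 (by omega)
  have r2 := hrec 2 (by omega)
  have r3 := hrec 3 (by omega)
  have d1 : (c G 1 : ℂ) + b G 1 = valency G := by
    exact_mod_cast c_add_b hG hbip (i := 1) (by omega)
  have d2 : (c G 2 : ℂ) + b G 2 = valency G := by
    exact_mod_cast c_add_b hG hbip (i := 2) (by omega)
  have d3 : (c G 3 : ℂ) + b G 3 = valency G := by
    exact_mod_cast c_add_b hG hbip (i := 3) (by omega)
  rw [c_zero hG] at r0
  rw [c_one hG (by omega)] at r1 d1
  have hk0 : (b G 0 : ℂ) = valency G := rfl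
  rw [hk0] at r0
  simp only [Nat.reduceSub, Nat.reduceAdd, Nat.cast_zero, Nat.cast_one, zero_mul, zero_add,
    one_mul] at r0 r1 r2 r3 d1
  have hX : (Fintype.card X : ℂ) ≠ 0 := by
    have := hG.connected.nonempty
    exact Nat.cast_ne_zero.mpr Fintype.card_ne_zero
  have hk : (valency G : ℂ) ≠ 0 := Nat.cast_ne_zero.mpr (b_pos hG (i := 0) (by omega)).ne'
  have hb1 : (b G 1 : ℂ) ≠ 0 := Nat.cast_ne_zero.mpr (b_pos hG (i := 1) (by omega)).ne'
  have hτ' : (τ : ℂ) ^ 2 - b G 2 ≠ 0 := by exact_mod_cast hτ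
  -- The form of `tilde` supplies exactly the factor `b_2 b_3` that clears the denominator of `q 4`.
  have hη1 : (1 + (η : ℂ)) * ((τ : ℂ) ^ 2 - b G 2) = - (b G 2 * b G 3) := by
    rw [hηdef, tilde]
    push_cast
    field_simp
    ring
  apply Complex.ofReal_injective
  push_cast
  rw [hinner]
  congr 1
  rw [eq_div_iff (mul_ne_zero (mul_ne_zero (mul_ne_zero hX hk) hb1) hτ'), ← hq0]
  generalize (b G 1 : ℂ) = b1 at *
  generalize (b G 2 : ℂ) = b2 at *
  generalize (b G 3 : ℂ) = b3 at *
  generalize (c G 2 : ℂ) = c2 at *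
  generalize (c G 3 : ℂ) = c3 at *
  generalize (valency G : ℂ) = k at *
  -- Unroll the recurrence up to `q 4`, keeping denominators on the left; after eliminating `b_1`,
  -- `c_2`, `c_3` through `c_i + b_i = k`, a polynomial identity remains.
  have e2 : k * b1 * q 2 = ((θ : ℂ) ^ 2 - k) * q 0 := by
    linear_combination k * r1 + θ * r0
  have e3 : k * b1 * b2 * q 3 = θ * ((θ : ℂ) ^ 2 - k - c2 * b1) * q 0 := by
    linear_combination k * b1 * r2 + θ * e2 - c2 * b1 * r0
  have e4 : k * b1 * b2 * b3 * q 4 =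
      ((θ : ℂ) ^ 2 * ((θ : ℂ) ^ 2 - k - c2 * b1) - c3 * b2 * ((θ : ℂ) ^ 2 - k)) * q 0 := by
    linear_combination k * b1 * b2 * r3 + θ * e3 - c3 * b2 * e2
  have e : k * b1 * ((τ : ℂ) ^ 2 - b2) * (q 0 + η * q 2 - (1 + η) * q 4) =
      q 0 * ((θ : ℂ) ^ 2 - k ^ 2) * ((θ : ℂ) ^ 2 - (τ : ℂ) ^ 2) := by
    obtain rfl : b1 = k - 1 := by linear_combination d1
    obtain rfl : c2 = k - b2 := by linear_combination d2
    obtain rfl : c3 = k - b3 := by linear_combination d3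
    linear_combination (k * (k - 1) * (q 2 - q 4)) * hη1 + e4 - (τ ^ 2 - b2 + b2 * b3) * e2
  linear_combination (Fintype.card X : ℂ) * e

end Norm

end DRG

theorem mainTheorem7 {X : Type*} [Fintype X] [DecidableEq X] (G : SimpleGraph X)
    (hG : DRG.IsDistanceRegular G) (hbip : G.IsBipartite)
    (hD : 4 ≤ G.diam) (hk : 3 ≤ DRG.valency G)
    (x : X) (n : ℕ) (hn : n = 1 ∨ (Odd G.diam ∧ n = G.diam / 2))
    (W : Submodule ℂ (EuclideanSpace ℂ X))
    (hW : DRG.IsIrreducibleTModule G x W) (hthin : DRG.IsThin G x W)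
    (hend : DRG.endpoint G x W = 2)
    (hloc : DRG.HasLocalEigenvalue G x W (DRG.tilde G (DRG.eigenvalue G n)))
    (v : EuclideanSpace ℂ X) (hv : v ∈ DRG.dualComponent G x 2 W) (hv0 : v ≠ 0) :
    (∀ i ∈ Finset.Icc 1 (G.diam - 1), i ≠ n → i ≠ G.diam - n →
      ∀ j ∈ Finset.Icc 1 (G.diam - 1), j ≠ n → j ≠ G.diam - n → i ≠ j →
        inner ℂ (DRG.act (DRG.primitiveIdempotent G i) v)
          (DRG.act (DRG.primitiveIdempotent G j) v) = 0) ∧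
    (Fintype.card X : ℝ) * DRG.valency G * DRG.b G 1 *
      (DRG.eigenvalue G n ^ 2 - DRG.b G 2) ≠ 0 ∧
    (∀ i ∈ Finset.Icc 1 (G.diam - 1), i ≠ n → i ≠ G.diam - n →
      ‖DRG.act (DRG.primitiveIdempotent G i) v‖ ^ 2 =
        (DRG.multiplicity G i : ℝ) *
            (DRG.eigenvalue G i ^ 2 - (DRG.valency G : ℝ) ^ 2) *
            (DRG.eigenvalue G i ^ 2 - DRG.eigenvalue G n ^ 2) /
          ((Fintype.card X : ℝ) * DRG.valency G * DRG.b G 1 *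
            (DRG.eigenvalue G n ^ 2 - DRG.b G 2)) * ‖v‖ ^ 2) := by

  have hden := DRG.eigenvalue_sq_ne_b hG hbip hD hn
  refine ⟨fun i hi _ _ j hj _ _ hij => ?_, ?_, fun i _ _ _ => ?_⟩
  · rw [Finset.mem_Icc] at hi hj
    have hne : DRG.eigenvalue G i ≠ DRG.eigenvalue G j := by
      rcases lt_or_gt_of_ne hij with h | h
      · exact (DRG.eigenvalue_lt hG hbip h (by omega)).ne'
      · exact (DRG.eigenvalue_lt hG hbip h (by omega)).ne
    -- `primitiveIdempotent G i` is by definition `eigenprojection G (eigenvalue G i)`.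
    exact DRG.inner_eq_zero_of_eigenvector hne
      (DRG.act_adjacencyMatrix_eigenprojection G _ v)
      (DRG.act_adjacencyMatrix_eigenprojection G _ v)
  · have := hG.connected.nonempty
    have hX : (Fintype.card X : ℝ) ≠ 0 := Nat.cast_ne_zero.mpr Fintype.card_ne_zero
    have hb : (DRG.b G 1 : ℝ) ≠ 0 :=
      Nat.cast_ne_zero.mpr (DRG.b_pos hG (i := 1) (by omega)).ne'
    have hv : (DRG.valency G : ℝ) ≠ 0 := Nat.cast_ne_zero.mpr (by omega)
    exact mul_ne_zero (mul_ne_zero (mul_ne_zero hX hv) hb) hden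
  · exact DRG.norm_act_eigenprojection_sq_of_tilde hG hbip hD hW.isTModule (by omega) hden hloc hv _
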